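/- Let $p>2$ be a prime, $k$ a perfect field of characteristic $p$, $d\ge 0$, $0\le r\le p-2$, and $R=W(k)[\![t_1,\dots,t_d]\!]$ with the Frobenius lift $\varphi$ that extends the Witt vector Frobenius of $W(k)$ and satisfies $\varphi(t_i)=(1+t_i)^p-1$. Let $\bar b:R\to W(k)$ be the $W(k)$-algebra map with $t_i\mapsto 0$. Let $k_g$ be the perfection (perfect closure) of $\mathrm{Frac}(R/pR)$, let $R_g=W(k_g)$, and let $b_g:R\hookrightarrow R_g$ be the $\varphi$-compatible embedding that lifts $R\to R/pR\to k_g$. For a ring $A$ with an endomorphism $\varphi$, a big Fontaine–Laffaille module over $A$ consists of $A$-modules $M$ and $\mathrm F^i(M)$ ($i\in\mathbb Z$), $A$-linear maps $\iota_i:\mathrm F^i(M)\to \mathrm F^{i-1}(M)$ and $\pi_i:\mathrm F^i(M)\to M$, and $\varphi$-semilinear maps $\varphi_i:\mathrm F^i(M)\to M$ such that $\pi_{i-1}\iota_i=\pi_i$, $\varphi_{i-1}\iota_i=p\varphi_i$, and $\pi_i$ is an isomorphism for $i\ll 0$. It has weights in $[0,r]$ if $\pi_0$ is an isomorphism and $\mathrm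 F^{r+1}(M)=0$. It is finite free if $M$ and all $\mathrm F^i(M)$ are finite free $A$-modules. It lies in $\mathrm{MF}^{\mathrm{ff}}(A)$ if it is finite free, every $\iota_i$ is injective with image a direct summand, $\mathrm F^i(M)=0$ for $i\gg0$, and the sets $\varphi_i(\mathrm F^i(M))$ together generate $M$ as an $A$-module. For $\kappa$ a perfect field of characteristic $p$, a classical Fontaine–Laffaille module over $W(\kappa)$ with weights in $[0,r]$ is a finite free $W(\kappa)$-module $N$ with a decreasing filtration $(\mathrm{Fil}^iN)_{i\ge0}$ such that $\mathrm{Fil}^{i+1}N$ is a direct summand of $\mathrm{Fil}^iN$, $\mathrm{Fil}^0N=N$ and $\mathrm{Fil}^{r+1}N=0$, and with Frobenius-semilinear maps $\varphi_i:\mathrm{Fil}^iN\to N$ such that $\varphi_i|_{\mathrm{Fil}^{i+1}N}=p\varphi_{i+1}$ and $\sum_i\varphi_i(\mathrm{Fil}^iN)=N$. It is regarded as a big module with $\mathrm F^i=\mathrm{Fil}^iN$ for $i\ge0$ and $\mathrm F^i=N$, $\varphi_i=p^{-i}\varphi_0$ for $i\le0$. **Proposition.** Let $M$ be a finite free big Fontaine–Laffaille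 module over $R$ with weights in $[0,r]$. Then $M$ lies in $\mathrm{MF}^{\mathrm{ff}}(R)$ if and only if both of the following hold: 1. The base changes $M_0=M\otimes_{R,\bar b}W(k)$ and $M_g=M\otimes_{R,b_g}R_g$, formed by tensoring $M$ and all $\mathrm F^i(M)$ and extending the maps (semi)linearly, are (isomorphic to) classical Fontaine–Laffaille modules with weights in $[0,r]$ over $W(k)$ and $R_g=W(k_g)$ respectively. 2. $M_g\cong M_0\otimes_{W(k)}R_g$ as $R_g$-modules. -/

import Mathlib

open scoped TensorProduct

noncomputable section

namespace FL

/-! ### Big Fontaine-Laffaille modules over a ring with a Frobenius -/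

/-- A big Fontaine-Laffaille module over a ring `A` with an endomorphism `φ`: the underlying module
is `M`, and `F i` is the module in filtration degree `i ∈ ℤ`. The maps `π i : F i → M` need not be
injective. -/
structure BigModule (p : ℕ) {A : Type*} [CommRing A] (φ : A →+* A)
    (M : Type*) [AddCommGroup M] [Module A M]
    (F : ℤ → Type*) [∀ i, AddCommGroup (F i)] [∀ i, Module A (F i)] where
  /-- the transition maps -/
  ι : ∀ i : ℤ, F i →ₗ[A] F (i - 1)
  /-- the maps to the underlying module -/
  π : ∀ i : ℤ, F i →ₗ[A] M
  /-- the divided Frobenius maps, which are `φ`-semilinear -/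
  frob : ∀ i : ℤ, F i →ₛₗ[φ] M
  π_ι : ∀ (i : ℤ) (x : F i), π (i - 1) (ι i x) = π i x
  π_bijective : ∃ N : ℤ, ∀ i ≤ N, Function.Bijective (π i)
  frob_ι : ∀ (i : ℤ) (x : F i), frob (i - 1) (ι i x) = (p : A) • frob i x

namespace BigModule

section

variable {p : ℕ} {A : Type*} [CommRing A] {φ : A →+* A}
  {M : Type*} [AddCommGroup M] [Module A M]
  {F : ℤ → Type*} [∀ i, AddCommGroup (F i)] [∀ i, Module A (F i)]
  {M' : Type*} [AddCommGroup M'] [Module A M']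
  {F' : ℤ → Type*} [∀ i, AddCommGroup (F' i)] [∀ i, Module A (F' i)]

/-- The module is of weights in `[a, b]`: `F^a(M) = M` (via `π_a`) and `F^{b+1}(M) = 0`. -/
def HasWeights (X : BigModule p φ M F) (a b : ℤ) : Prop :=
  Function.Bijective (X.π a) ∧ Subsingleton (F (b + 1))

/-- `M` and all the `F^i(M)` are finite free `A`-modules. -/
def IsFiniteFree (_X : BigModule p φ M F) : Prop :=
  (Module.Finite A M ∧ Module.Free A M) ∧ ∀ i, Module.Finite A (F i) ∧ Module.Free A (F i)

/-- The big Fontaine-Laffaille module is a finite free Fontaine-Laffaille module, that is, an object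
of `MF^ff(A)`: `M` and the `F^i(M)` are finite free, each `F^{i+1}(M)` is (via the transition map) a
direct summand of `F^i(M)`, `F^i(M) = 0` for `i ≫ 0`, and the `φ_i(F^i(M))` generate `M`. -/
structure IsFontaineLaffaille (X : BigModule p φ M F) : Prop where
  finiteFree : X.IsFiniteFree
  ι_injective : ∀ i, Function.Injective (X.ι i)
  ι_isCompl : ∀ i, ∃ Q : Submodule A (F (i - 1)), IsCompl (LinearMap.range (X.ι i)) Q
  eventually_zero : ∃ N : ℤ, ∀ i ≥ N, Subsingleton (F i)
  span_frob : Submodule.span A (⋃ i, Set.range (X.frob i)) = ⊤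

/-- An isomorphism of big Fontaine-Laffaille modules. -/
structure Iso (X : BigModule p φ M F) (X' : BigModule p φ M' F') where
  /-- the isomorphism of underlying modules -/
  equiv : M ≃ₗ[A] M'
  /-- the isomorphisms in each filtration degree -/
  filEquiv : ∀ i, F i ≃ₗ[A] F' i
  filEquiv_ι : ∀ i x, filEquiv (i - 1) (X.ι i x) = X'.ι i (filEquiv i x)
  equiv_π : ∀ i x, equiv (X.π i x) = X'.π i (filEquiv i x)
  equiv_frob : ∀ i x, equiv (X.frob i x) = X'.frob i (filEquiv i x)

end

section BaseChange

variable {p : ℕ} {A : Type*} [CommRing A] {φ : A →+* A}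
  {M : Type*} [AddCommGroup M] [Module A M]
  {N : Type*} [AddCommGroup N] [Module A N]
  {F : ℤ → Type*} [∀ i, AddCommGroup (F i)] [∀ i, Module A (F i)]
  {B : Type*} [CommRing B] [Algebra A B] (ψ : B →+* B)

/-- The `ψ`-semilinear map `B ⊗ N → B ⊗ M`, `b ⊗ x ↦ ψ(b) ⊗ f(x)`, for a `φ`-semilinear map
`f : N → M`, where `A → B` is compatible with `φ` and `ψ`. -/
def semilinearBaseChange (h : ∀ a : A, ψ (algebraMap A B a) = algebraMap A B (φ a))
    (f : N →ₛₗ[φ] M) : B ⊗[A] N →ₛₗ[ψ] B ⊗[A] M :=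
  let ψ' : B →ₛₗ[φ] B :=
    { toFun := ψ
      map_add' := map_add ψ
      map_smul' := fun a b => by rw [Algebra.smul_def, map_mul, h, Algebra.smul_def] }
  { toFun := TensorProduct.map ψ' f
    map_add' := map_add _
    map_smul' := fun b x => by
      induction x with
      | zero => simp
      | add x y hx hy => rw [smul_add, map_add, hx, hy, map_add, smul_add]
      | tmul c n =>
        rw [TensorProduct.smul_tmul', TensorProduct.map_tmul, TensorProduct.map_tmul,
          TensorProduct.smul_tmul', smul_eq_mul, smul_eq_mul]
        exact congrArg (· ⊗ₜ[A] f n) (map_mul ψ b c) }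

theorem semilinearBaseChange_tmul (h : ∀ a : A, ψ (algebraMap A B a) = algebraMap A B (φ a))
    (f : N →ₛₗ[φ] M) (b : B) (x : N) :
    semilinearBaseChange ψ h f (b ⊗ₜ x) = ψ b ⊗ₜ f x := rfl

/-- The base change of a big Fontaine-Laffaille module along a Frobenius-compatible map `A → B`:
all modules are tensored with `B`. -/
def baseChange (X : BigModule p φ M F)
    (h : ∀ a : A, ψ (algebraMap A B a) = algebraMap A B (φ a)) :
    BigModule p ψ (B ⊗[A] M) (fun i => B ⊗[A] F i) where
  ι i := (X.ι i).baseChange B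
  π i := (X.π i).baseChange B
  frob i := semilinearBaseChange ψ h (X.frob i)
  π_ι i x := by
    induction x with
    | zero => simp
    | add x y hx hy => simp only [map_add, hx, hy]
    | tmul b x => simp [X.π_ι]
  π_bijective := by
    obtain ⟨N, hN⟩ := X.π_bijective
    refine ⟨N, fun i hi => ?_⟩
    exact ((LinearEquiv.ofBijective (X.π i) (hN i hi)).baseChange A B _ _).bijective
  frob_ι i x := by
    induction x with
    | zero => simp
    | add x y hx hy => simp only [map_add, hx, hy, smul_add]
    | tmul b x =>
      rw [LinearMap.baseChange_tmul, semilinearBaseChange_tmul, semilinearBaseChange_tmul, X.frob_ι]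
      simp only [Nat.cast_smul_eq_nsmul, TensorProduct.tmul_smul]

end BaseChange

end BigModule

/-! ### Classical Fontaine-Laffaille modules -/

section Classical

variable (p : ℕ) [Fact p.Prime]

/-- A classical finite free Fontaine-Laffaille module over `W(κ)`, with weights in `[0, r]`, on the
module `M`. -/
structure ClassicalModule (r : ℕ) (κ : Type*) [CommRing κ]
    (M : Type*) [AddCommGroup M] [Module (WittVector p κ) M] where
  finite : Module.Finite (WittVector p κ) M
  free : Module.Free (WittVector p κ) M
  /-- the filtration -/
  Fil : ℕ → Submodule (WittVector p κ) M
  Fil_succ_le : ∀ i, Fil (i + 1) ≤ Fil i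
  /-- `Fil (i + 1)` is a direct summand of `Fil i` -/
  exists_compl : ∀ i, ∃ Q, Fil (i + 1) ⊔ Q = Fil i ∧ Disjoint (Fil (i + 1)) Q
  Fil_zero : Fil 0 = ⊤
  Fil_last : Fil (r + 1) = ⊥
  /-- the divided Frobenius maps -/
  frob : ∀ i, Fil i →ₛₗ[WittVector.frobenius (p := p) (R := κ)] M
  frob_succ : ∀ (i : ℕ) (x : Fil (i + 1)),
    frob i ⟨x, Fil_succ_le i x.2⟩ = (p : WittVector p κ) • frob (i + 1) x
  /-- `M` is the sum of the images of the `φ_i` -/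
  sum_frob : ⨆ i, (frob i).toAddMonoidHom.range = ⊤

variable {p}

/-- A classical Fontaine-Laffaille module as a big one: `F^i = Fil^i` for `i ≥ 0`, and for `i ≤ 0`
one has `F^i = M` with `φ_i = p^{-i} φ_0`. -/
def ClassicalModule.toBig {r : ℕ} {κ : Type*} [CommRing κ]
    {M : Type*} [AddCommGroup M] [Module (WittVector p κ) M] (C : ClassicalModule p r κ M) :
    BigModule p (WittVector.frobenius (p := p) (R := κ)) M (fun i => C.Fil i.toNat) where
  ι i := Submodule.inclusion (antitone_nat_of_succ_le C.Fil_succ_le (by lia))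
  π i := (C.Fil i.toNat).subtype
  frob i := (p : WittVector p κ) ^ (-i).toNat • C.frob i.toNat
  π_ι i x := rfl
  π_bijective := by
    refine ⟨0, fun i hi => ⟨Subtype.val_injective, fun x => ⟨⟨x, ?_⟩, rfl⟩⟩⟩
    have h : i.toNat = 0 := by lia
    rw [h, C.Fil_zero]
    trivial
  frob_ι i x := by
    have key : ∀ (m n : ℕ) (hmn : m = n) (y : C.Fil m) (z : C.Fil n), (y : M) = z →
        C.frob m y = C.frob n z := by
      rintro m _ rfl y z h
      rw [Subtype.ext h]
    rcases le_or_gt i 0 with hi | hi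
    · have h1 : (-(i - 1)).toNat = (-i).toNat + 1 := by lia
      simp only [LinearMap.smul_apply, h1, pow_succ', mul_smul]
      congr 2
      exact key _ _ (by lia) _ _ rfl
    · obtain ⟨n, rfl⟩ : ∃ n : ℕ, i = (n : ℤ) + 1 := ⟨(i - 1).toNat, by lia⟩
      have h1 : (-((n : ℤ) + 1 - 1)).toNat = 0 := by lia
      have h2 : (-((n : ℤ) + 1)).toNat = 0 := by lia
      simp only [h1, h2, pow_zero, one_smul]
      have hx : (x : M) ∈ C.Fil (n + 1) := x.2
      rw [key _ (n + 1) (by lia) x ⟨x, hx⟩ rfl, ← C.frob_succ]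
      exact key _ _ (by lia) _ _ rfl

/-- A big module over `W(κ)` is a classical Fontaine-Laffaille module with weights in `[0, r]` when
it is isomorphic to the big module given by a classical one. -/
def BigModule.IsClassical {κ : Type*} [CommRing κ]
    {M : Type*} [AddCommGroup M] [Module (WittVector p κ) M]
    {F : ℤ → Type*} [∀ i, AddCommGroup (F i)] [∀ i, Module (WittVector p κ) (F i)]
    (X : BigModule p (WittVector.frobenius (p := p) (R := κ)) M F) (r : ℕ) : Prop :=
  ∃ C : ClassicalModule p r κ M, Nonempty (X.Iso C.toBig)

end Classical

/-! ### The Witt vector lift of a ring with a Frobenius lift -/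

section Lift

variable (p : ℕ) [Fact p.Prime] {A : Type*} [CommRing A] (φ : A →+* A)

theorem ghostMap_injective (h : ∀ a : A, (p : A) * a = 0 → a = 0) :
    Function.Injective (WittVector.ghostMap : WittVector p A →+* ℕ → A) := by
  have hpow : ∀ (n : ℕ) (a : A), (p : A) ^ n * a = 0 → a = 0 := by
    intro n
    induction n with
    | zero => intro a ha; simpa using ha
    | succ n ih => intro a ha; exact ih a (h _ (by rw [← ha]; ring))
  intro x y hxy
  ext n
  induction n using Nat.strong_induction_on with
  | _ n ih =>
    have e := congrFun hxy n
    simp only [WittVector.ghostMap_apply, WittVector.ghostComponent_apply,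
      aeval_wittPolynomial, Finset.sum_range_succ] at e
    rw [Finset.sum_congr rfl (fun i hi => by rw [ih i (Finset.mem_range.1 hi)])] at e
    have e' := add_left_cancel e
    simp only [Nat.sub_self, pow_zero, pow_one] at e'
    exact sub_eq_zero.1 (hpow n _ (by rw [mul_sub, e', sub_self]))

/-- For a Frobenius lift `φ`, the sequence `a, φ(a), φ²(a), …` is a sequence of ghost components. -/
theorem exists_ghost (hφ : ∀ a : A, (p : A) ∣ φ a - a ^ p) (a : A) :
    ∃ x : WittVector p A, WittVector.ghostMap x = fun n => (φ^[n]) a := by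
  have step : ∀ (c : ℕ → A) (n : ℕ), ∃ d : A,
      ∑ i ∈ Finset.range (n + 1), (p : A) ^ i * c i ^ p ^ (n - i) = (φ^[n]) a →
      ∑ i ∈ Finset.range (n + 1), (p : A) ^ i * c i ^ p ^ (n + 1 - i) +
        (p : A) ^ (n + 1) * d = (φ^[n + 1]) a := by
    intro c n
    by_cases hc : ∑ i ∈ Finset.range (n + 1), (p : A) ^ i * c i ^ p ^ (n - i) = (φ^[n]) a
    swap
    · exact ⟨0, fun h => absurd h hc⟩
    have hdvd : (p : A) ^ (n + 1) ∣ (φ^[n + 1]) a -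
        ∑ i ∈ Finset.range (n + 1), (p : A) ^ i * c i ^ p ^ (n + 1 - i) := by
      rw [Function.iterate_succ_apply', ← hc, map_sum, ← Finset.sum_sub_distrib]
      refine Finset.dvd_sum fun i hi => ?_
      have hi' : i ≤ n := Nat.lt_succ_iff.1 (Finset.mem_range.1 hi)
      have e1 : n + 1 - i = (n - i) + 1 := by lia
      have e2 : n + 1 = i + ((n - i) + 1) := by lia
      rw [map_mul, map_pow, map_pow, map_natCast, ← mul_sub, e1, pow_succ' p, pow_mul, e2, pow_add]
      exact mul_dvd_mul_left _ (dvd_sub_pow_of_dvd_sub (hφ (c i)) (n - i))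
    obtain ⟨d, hd⟩ := hdvd
    exact ⟨d, fun _ => by rw [← hd]; ring⟩
  choose d hd using step
  let G : ℕ → ℕ → A := fun n =>
    Nat.rec (fun _ => a) (fun n c => Function.update c (n + 1) (d c n)) n
  have hGs : ∀ n, G (n + 1) = Function.update (G n) (n + 1) (d (G n) n) := fun n => rfl
  have hG : ∀ n i, i ≤ n → G n i = G i i := by
    intro n
    induction n with
    | zero => intro i hi; rw [Nat.le_zero.1 hi]
    | succ n ih =>
      intro i hi
      rcases Nat.lt_or_ge n i with h | h
      · rw [show i = n + 1 by lia]
      · rw [hGs, Function.update_of_ne (by lia), ih i h]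
  have hsum : ∀ n, ∑ i ∈ Finset.range (n + 1), (p : A) ^ i * G n i ^ p ^ (n - i) =
      (φ^[n]) a := by
    intro n
    induction n with
    | zero => simp [G]
    | succ n ih =>
      rw [← hd (G n) n ih, Finset.sum_range_succ]
      congr 1
      · refine Finset.sum_congr rfl fun i hi => ?_
        have hi' := Finset.mem_range.1 hi
        rw [hG (n + 1) i (by lia), hG n i (by lia)]
      · simp [hGs]
  refine ⟨WittVector.mk p fun n => G n n, funext fun n => ?_⟩
  rw [WittVector.ghostMap_apply, WittVector.ghostComponent_apply, aeval_wittPolynomial, ← hsum n]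
  refine Finset.sum_congr rfl fun i hi => ?_
  rw [WittVector.coeff_mk, hG n i (Nat.lt_succ_iff.1 (Finset.mem_range.1 hi))]

/-- Iterates of `φ` as a ring homomorphism into sequences. -/
def iterateHom : A →+* (ℕ → A) := RingHom.pi fun n => φ ^ n

/-- For a `p`-torsion free ring `A` with a Frobenius lift `φ`, the ring homomorphism `A → W(A)`
whose ghost components are `a, φ(a), φ²(a), …`. -/
def wittLift (h : ∀ a : A, (p : A) * a = 0 → a = 0) (hφ : ∀ a : A, (p : A) ∣ φ a - a ^ p) :
    A →+* WittVector p A :=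
  ((RingEquiv.ofLeftInverse
      (f := (WittVector.ghostMap : WittVector p A →+* ℕ → A))
      (Function.leftInverse_invFun (ghostMap_injective p h))).symm : _ →+* WittVector p A).comp
    ((iterateHom φ).codRestrict (WittVector.ghostMap : WittVector p A →+* ℕ → A).range
      (fun a => by
        obtain ⟨x, hx⟩ := exists_ghost p φ hφ a
        exact ⟨x, by rw [hx]; funext n; exact (congrFun (RingHom.coe_pow φ n) a).symm⟩))

theorem ghostComponent_wittLift (h : ∀ a : A, (p : A) * a = 0 → a = 0)
    (hφ : ∀ a : A, (p : A) ∣ φ a - a ^ p) (a : A) (n : ℕ) :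
    WittVector.ghostComponent n (wittLift p φ h hφ a) = (φ^[n]) a := by
  have e : WittVector.ghostMap (wittLift p φ h hφ a) = iterateHom φ a :=
    congrArg Subtype.val (RingEquiv.apply_symm_apply (RingEquiv.ofLeftInverse
      (f := (WittVector.ghostMap : WittVector p A →+* ℕ → A))
      (Function.leftInverse_invFun (ghostMap_injective p h))) _)
  rw [← WittVector.ghostMap_apply, e]
  exact congrFun (RingHom.coe_pow φ n) a

theorem frobenius_wittLift (h : ∀ a : A, (p : A) * a = 0 → a = 0)
    (hφ : ∀ a : A, (p : A) ∣ φ a - a ^ p) (a : A) :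
    WittVector.frobenius (wittLift p φ h hφ a) = wittLift p φ h hφ (φ a) := by
  refine ghostMap_injective p h (funext fun n => ?_)
  rw [WittVector.ghostMap_apply, WittVector.ghostMap_apply, WittVector.ghostComponent_frobenius,
    ghostComponent_wittLift, ghostComponent_wittLift, Function.iterate_succ_apply]

end Lift

/-! ### The power series ring over the Witt vectors and its two fibres -/

section PowerSeries

theorem hasSubst_frob (p : ℕ) (d : ℕ) (A : Type*) [CommRing A] :
    MvPowerSeries.HasSubst
      (fun i : Fin d => (1 + MvPowerSeries.X i) ^ p - (1 : MvPowerSeries (Fin d) A)) :=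
  MvPowerSeries.hasSubst_of_constantCoeff_zero (by simp)

variable (p : ℕ) [Fact p.Prime] (k : Type*) [Field k] [CharP k p] (d : ℕ)

/-- The base ring `R = W(k)⟦t_1, …, t_d⟧`. -/
abbrev BaseRing : Type _ := MvPowerSeries (Fin d) (WittVector p k)

/-- The Frobenius of `R`: the Witt vector Frobenius on the coefficients, and
`t_i ↦ (1 + t_i)^p - 1`. -/
def frob : BaseRing p k d →+* BaseRing p k d :=
  (MvPowerSeries.substAlgHom (R := WittVector p k)
      (hasSubst_frob p d (WittVector p k))).toRingHom.comp
    (MvPowerSeries.map WittVector.frobenius)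

/-- Reduction `R → k⟦t_1, …, t_d⟧` of the coefficients. -/
def redHom : BaseRing p k d →+* MvPowerSeries (Fin d) k :=
  MvPowerSeries.map WittVector.constantCoeff

variable [PerfectRing k p]

theorem redHom_ker : RingHom.ker (redHom p k d) = Ideal.span {(p : BaseRing p k d)} := by
  ext f
  rw [RingHom.mem_ker, Ideal.mem_span_singleton]
  constructor
  · intro hf
    have hc : ∀ m, ∃ y : WittVector p k, MvPowerSeries.coeff m f = (p : WittVector p k) * y := by
      intro m
      have h1 : MvPowerSeries.coeff m f ∈
          RingHom.ker (WittVector.constantCoeff : WittVector p k →+* k) := by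
        have := congrArg (MvPowerSeries.coeff m) hf
        simpa [redHom, RingHom.mem_ker] using this
      rw [WittVector.ker_constantCoeff] at h1
      exact Ideal.mem_span_singleton.1 h1
    choose y hy using hc
    refine ⟨(fun m => y m : BaseRing p k d), ?_⟩
    ext1 m
    have : (p : BaseRing p k d) = MvPowerSeries.C (p : WittVector p k) := by simp
    rw [this]
    exact (hy m).trans (MvPowerSeries.coeff_C_mul m _ _).symm
  · rintro ⟨g, rfl⟩
    have : (redHom p k d) (p : BaseRing p k d) = 0 := by
      rw [map_natCast]
      have h0 : (p : k) = 0 := CharP.cast_eq_zero k p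
      have : (p : MvPowerSeries (Fin d) k) = MvPowerSeries.C (p : k) :=
        (map_natCast (MvPowerSeries.C (σ := Fin d) (R := k)) p).symm
      rw [this, h0, map_zero]
    rw [map_mul, this, zero_mul]

instance span_p_isPrime : (Ideal.span {(p : BaseRing p k d)}).IsPrime := by
  rw [← redHom_ker]
  have : IsDomain (MvPowerSeries (Fin d) k) := NoZeroDivisors.to_isDomain _
  exact RingHom.ker_isPrime _

/-- `R / pR`. -/
abbrev ModP : Type _ := BaseRing p k d ⧸ Ideal.span {(p : BaseRing p k d)}

instance modP_charP : CharP (ModP p k d) p := by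
  have h : ((p : ℕ) : ModP p k d) = 0 := by
    rw [← map_natCast (Ideal.Quotient.mk _), Ideal.Quotient.eq_zero_iff_mem]
    exact Ideal.mem_span_singleton_self _
  exact (CharP.charP_iff_prime_eq_zero Fact.out).2 h

theorem frob_lift (f : BaseRing p k d) : (p : BaseRing p k d) ∣ frob p k d f - f ^ p := by
  rw [← Ideal.mem_span_singleton, ← redHom_ker, RingHom.mem_ker, map_sub, map_pow, sub_eq_zero]
  have hp0 : p ≠ 0 := (Fact.out : p.Prime).ne_zero
  have : CharP (MvPowerSeries (Fin d) k) p :=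
    charP_of_injective_ringHom (f := MvPowerSeries.C (σ := Fin d) (R := k))
      MvPowerSeries.C_injective p
  have e1 : redHom p k d (frob p k d f) =
      MvPowerSeries.map WittVector.constantCoeff (MvPowerSeries.subst
        (fun i : Fin d => (1 + MvPowerSeries.X i) ^ p - (1 : BaseRing p k d))
        (MvPowerSeries.map WittVector.frobenius f)) := by
    rw [← MvPowerSeries.substAlgHom_apply (hasSubst_frob p d (WittVector p k))]
    rfl
  have e2 : MvPowerSeries.map WittVector.constantCoeff
      (MvPowerSeries.map (WittVector.frobenius (p := p) (R := k)) f) =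
      MvPowerSeries.map (frobenius k p) (redHom p k d f) := by
    ext m
    simp only [redHom, MvPowerSeries.coeff_map, WittVector.constantCoeff_apply,
      WittVector.coeff_frobenius_charP, frobenius_def]
  have e3 : (fun i : Fin d => MvPowerSeries.map (WittVector.constantCoeff (p := p) (R := k))
      ((1 + MvPowerSeries.X i) ^ p - (1 : BaseRing p k d))) =
      fun i => MvPowerSeries.X i ^ p := by
    funext i
    rw [map_sub, map_pow, map_add, map_one, MvPowerSeries.map_X, add_pow_char, one_pow,
      add_sub_cancel_left]
  rw [e1, MvPowerSeries.map_subst (hasSubst_frob p d (WittVector p k)), e2, e3,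
    ← MvPowerSeries.map_frobenius_expand (p := p) hp0, MvPowerSeries.map_expand,
    MvPowerSeries.expand, MvPowerSeries.substAlgHom_apply]

theorem p_torsionFree (f : BaseRing p k d) (h : (p : BaseRing p k d) * f = 0) : f = 0 := by
  have hp0 : (p : WittVector p k) ≠ 0 := WittVector.p_nonzero p k
  have hC : (p : BaseRing p k d) = MvPowerSeries.C (p : WittVector p k) := by simp
  ext1 m
  have := congrArg (MvPowerSeries.coeff m) h
  rw [hC, MvPowerSeries.coeff_C_mul, map_zero] at this
  rw [map_zero]
  exact (mul_eq_zero.1 this).resolve_left hp0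

/-- The residue field `k_g` at the Shilov point: the perfect closure of `Frac(R/pR)`. -/
abbrev ShilovField : Type _ := PerfectClosure (FractionRing (ModP p k d)) p

/-- The ring `R_g = W(k_g)`. -/
abbrev ShilovRing : Type _ := WittVector p (ShilovField p k d)

/-- The map `R → R/pR → Frac(R/pR) → k_g`. -/
def toShilovField : BaseRing p k d →+* ShilovField p k d :=
  (PerfectClosure.of (FractionRing (ModP p k d)) p).comp
    ((algebraMap (ModP p k d) (FractionRing (ModP p k d))).comp (Ideal.Quotient.mk _))

/-- The Frobenius-compatible embedding `b_g : R → R_g`, the composite `R → W(R) → W(k_g)` of the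
map given by the Frobenius lift and of the map induced by `R → k_g`. -/
def shilovMap : BaseRing p k d →+* ShilovRing p k d :=
  (WittVector.map (toShilovField p k d)).comp
    (wittLift p (frob p k d) (p_torsionFree p k d) (frob_lift p k d))

instance shilovAlgebra : Algebra (BaseRing p k d) (ShilovRing p k d) :=
  (shilovMap p k d).toAlgebra

/-- `R_g` as a `W(k)`-algebra, through `W(k) ⊆ R → R_g`. -/
instance shilovAlgebraWitt : Algebra (WittVector p k) (ShilovRing p k d) :=
  ((shilovMap p k d).comp MvPowerSeries.C).toAlgebra

/-- `W(k)` as an `R`-algebra, through the projection `R → W(k)`, `t_i ↦ 0`. -/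
instance closedAlgebra : Algebra (BaseRing p k d) (WittVector p k) :=
  (MvPowerSeries.constantCoeff (σ := Fin d) (R := WittVector p k)).toAlgebra

theorem shilov_frob (f : BaseRing p k d) :
    WittVector.frobenius (algebraMap (BaseRing p k d) (ShilovRing p k d) f) =
      algebraMap (BaseRing p k d) (ShilovRing p k d) (frob p k d f) := by
  change WittVector.frobenius (WittVector.map _ _) = WittVector.map _ _
  rw [← frobenius_wittLift]
  exact ((WittVector.frobenius_isPoly p).map _ _).symm

theorem closed_frob (f : BaseRing p k d) :
    WittVector.frobenius (algebraMap (BaseRing p k d) (WittVector p k) f) =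
      algebraMap (BaseRing p k d) (WittVector p k) (frob p k d f) := by
  change WittVector.frobenius (MvPowerSeries.constantCoeff f) =
    MvPowerSeries.constantCoeff (frob p k d f)
  let c : BaseRing p k d := MvPowerSeries.C (MvPowerSeries.constantCoeff f)
  have h1 : MvPowerSeries.constantCoeff (frob p k d (f - c)) = 0 := by
    change MvPowerSeries.constantCoeff (MvPowerSeries.substAlgHom (R := WittVector p k)
      (hasSubst_frob p d (WittVector p k)) _) = 0
    rw [MvPowerSeries.substAlgHom_apply]
    refine MvPowerSeries.constantCoeff_subst_eq_zero (hasSubst_frob p d _) (by simp) ?_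
    simp [c]
  have h2 : frob p k d c =
      MvPowerSeries.C (WittVector.frobenius (MvPowerSeries.constantCoeff f)) := by
    change MvPowerSeries.substAlgHom (R := WittVector p k)
      (hasSubst_frob p d (WittVector p k)) (MvPowerSeries.map _ _) = _
    rw [MvPowerSeries.map_C]
    exact (MvPowerSeries.substAlgHom (R := WittVector p k)
      (hasSubst_frob p d (WittVector p k))).commutes _
  rw [map_sub, map_sub, h2, MvPowerSeries.constantCoeff_C, sub_eq_zero] at h1
  exact h1.symm

end PowerSeries

section Fibres

variable {p : ℕ} [Fact p.Prime] {k : Type*} [Field k] [CharP k p] [PerfectRing k p] {d : ℕ}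
  {M : Type*} [AddCommGroup M] [Module (BaseRing p k d) M]
  {F : ℤ → Type*} [∀ i, AddCommGroup (F i)] [∀ i, Module (BaseRing p k d) (F i)]

/-- The fibre `M_0 = M ⊗_R W(k)` at the closed point. -/
def closedFibre (X : BigModule p (frob p k d) M F) :
    BigModule p (WittVector.frobenius (p := p) (R := k)) (WittVector p k ⊗[BaseRing p k d] M)
      (fun i => WittVector p k ⊗[BaseRing p k d] F i) :=
  X.baseChange WittVector.frobenius (closed_frob p k d)

/-- The fibre `M_g = M ⊗_R R_g` at the Shilov point. -/
def shilovFibre (X : BigModule p (frob p k d) M F) :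
    BigModule p (WittVector.frobenius (p := p) (R := ShilovField p k d))
      (ShilovRing p k d ⊗[BaseRing p k d] M) (fun i => ShilovRing p k d ⊗[BaseRing p k d] F i) :=
  X.baseChange WittVector.frobenius (shilov_frob p k d)

end Fibres

end FL

end

/-!
The second condition holds for every finite free `M`: both sides are free over `R_g` on the same
basis as `M` over `R`. So the content lies in the comparison of `M` with its fibres.

If `M` is in `MF^ff(R)`, its defining properties pass to any Frobenius-compatible base change
(`BigModule.IsFontaineLaffaille.baseChange`): a direct summand is the image of an injection with a
retraction, and generators stay generators. Both fibres live over Witt vectors of a perfect field,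
and there an object of `MF^ff` with weights in `[0, r]` is classical
(`BigModule.IsFontaineLaffaille.isClassical`): all `π_i` are injective, since the `ι_i` are and
`π_i` is an isomorphism for `i ≪ 0`, so that `F^i` is determined by the image of `π_i`, which is all
of `M` for `i ≤ 0`. This forces `φ_i = p^{-i} φ_0` for `i ≤ 0`, so the `φ_i` with `i ≥ 0` suffice to
generate `M`; their images are already submodules because the Frobenius of `W(κ)` is surjective.

Conversely, the closed fibre alone decides membership in `MF^ff(R)`
(`BigModule.IsFiniteFree.isFontaineLaffaille_of_isClassical_baseChange`). The kernel of `R → W(k)`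
lies in the Jacobson radical, so Nakayama's lemma applies along this map. It gives the vanishing of
`F^i` for `i > r` and the generation of `M` by the images of the `φ_i`. A retraction of
`ι_i ⊗ W(k)` lifts to a map `t` because `F^{i-1}` is free, and `t ∘ ι_i` is a surjective, hence
bijective, endomorphism of `F^i` by Nakayama; this splits `ι_i` over `R`.
-/

namespace FL

open BigModule

/-! ### Split injections and direct summands -/

section Split

variable {A : Type*} [CommRing A]
  {M : Type*} [AddCommGroup M] [Module A M] {N : Type*} [AddCommGroup N] [Module A N]

theorem injective_and_exists_isCompl_range_iff (f : M →ₗ[A] N) :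
    (Function.Injective f ∧ ∃ Q : Submodule A N, IsCompl (LinearMap.range f) Q) ↔
      ∃ s : N →ₗ[A] M, s ∘ₗ f = LinearMap.id := by
  constructor
  · rintro ⟨hf, Q, hQ⟩
    let e := LinearEquiv.ofInjective f hf
    refine ⟨e.symm.toLinearMap ∘ₗ Submodule.projectionOnto _ Q hQ, LinearMap.ext fun x => ?_⟩
    have h : Submodule.projectionOnto _ Q hQ (f x) = e x :=
      Submodule.projectionOnto_apply_left hQ (e x)
    simp [h]
  · rintro ⟨s, hs⟩
    have hs' : ∀ x, s (f x) = x := LinearMap.congr_fun hs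
    refine ⟨Function.LeftInverse.injective hs', LinearMap.ker s, ?_⟩
    rw [isCompl_iff, Submodule.disjoint_def, codisjoint_iff, eq_top_iff]
    constructor
    · rintro _ ⟨x, rfl⟩ hx
      rw [LinearMap.mem_ker, hs'] at hx
      rw [hx, map_zero]
    · intro y _
      rw [← add_sub_cancel (f (s y)) y]
      exact Submodule.add_mem_sup ⟨_, rfl⟩ (by simp [hs'])

theorem exists_retraction_inclusion {P P' Q : Submodule A N} (hPP' : P ≤ P')
    (hsup : P ⊔ Q = P') (hdisj : Disjoint P Q) :
    ∃ s : P' →ₗ[A] P, s ∘ₗ Submodule.inclusion hPP' = LinearMap.id := by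
  rw [← injective_and_exists_isCompl_range_iff]
  refine ⟨Submodule.inclusion_injective _, Q.submoduleOf P', ?_⟩
  rw [Submodule.range_inclusion, isCompl_iff]
  constructor
  · rw [Submodule.disjoint_def] at hdisj ⊢
    exact fun x hx hx' => Subtype.ext (hdisj x hx hx')
  · rw [codisjoint_iff, eq_top_iff]
    rintro ⟨x, hx⟩ -
    obtain ⟨y, hy, z, hz, rfl⟩ := Submodule.mem_sup.1 (hsup ▸ hx : x ∈ P ⊔ Q)
    refine Submodule.mem_sup.2 ⟨⟨y, hPP' hy⟩, hy, ⟨z, hsup ▸ Submodule.mem_sup_right hz⟩, hz, rfl⟩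

end Split

/-! ### Nakayama's lemma along a surjection with kernel in the Jacobson radical -/

section Nakayama

variable {A : Type*} [CommRing A] {B : Type*} [CommRing B] [Algebra A B]
  {M : Type*} [AddCommGroup M] [Module A M] {N : Type*} [AddCommGroup N] [Module A N]

theorem subsingleton_of_subsingleton_baseChange [Module.Finite A M]
    (hsurj : Function.Surjective (algebraMap A B))
    (hker : RingHom.ker (algebraMap A B) ≤ (⊥ : Ideal A).jacobson)
    [Subsingleton (B ⊗[A] M)] : Subsingleton M := by
  let I : Ideal A := RingHom.ker (Algebra.ofId A B)
  let e : (A ⧸ I) ≃ₐ[A] B := Ideal.quotientKerAlgEquivOfSurjective (f := Algebra.ofId A B) hsurj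
  let e' : B ⊗[A] M ≃ₗ[A] M ⧸ (I • (⊤ : Submodule A M)) :=
    (TensorProduct.congr e.symm.toLinearEquiv (LinearEquiv.refl A M)).trans
      (TensorProduct.quotTensorEquivQuotSMul M I)
  have h : Subsingleton (M ⧸ (I • (⊤ : Submodule A M))) := e'.symm.injective.subsingleton
  rw [Submodule.Quotient.subsingleton_iff] at h
  have h' := Submodule.eq_bot_of_le_smul_of_le_jacobson_bot I (⊤ : Submodule A M)
    Module.Finite.fg_top h.ge hker
  exact (Submodule.subsingleton_iff A).1 (subsingleton_of_bot_eq_top h'.symm)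

theorem eq_top_of_baseChange_eq_top [Module.Finite A M]
    (hsurj : Function.Surjective (algebraMap A B))
    (hker : RingHom.ker (algebraMap A B) ≤ (⊥ : Ideal A).jacobson)
    {P : Submodule A M} (hP : P.baseChange B = ⊤) : P = ⊤ := by
  rw [← Submodule.Quotient.subsingleton_iff]
  have hzero : ∀ x : B ⊗[A] M, P.mkQ.baseChange B x = 0 := by
    intro x
    have hx : x ∈ P.baseChange B := hP ▸ Submodule.mem_top
    rw [Submodule.baseChange_eq_span] at hx
    induction hx using Submodule.span_induction with
    | mem x hx =>
      obtain ⟨y, hy, rfl⟩ := hx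
      simp [(Submodule.Quotient.mk_eq_zero P).2 hy]
    | zero => exact map_zero _
    | add x y _ _ hx hy => rw [map_add, hx, hy, add_zero]
    | smul b x _ hx => rw [map_smul, hx, smul_zero]
  have : Subsingleton (B ⊗[A] (M ⧸ P)) := by
    refine subsingleton_of_forall_eq 0 fun y => ?_
    obtain ⟨x, rfl⟩ := LinearMap.lTensor_surjective B P.mkQ_surjective y
    exact hzero x
  exact subsingleton_of_subsingleton_baseChange hsurj hker

/-- A map into a free module is split injective as soon as its base change is. -/
theorem exists_retraction_of_baseChange [Module.Finite A M] [Module.Free A N]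
    (hsurj : Function.Surjective (algebraMap A B))
    (hker : RingHom.ker (algebraMap A B) ≤ (⊥ : Ideal A).jacobson) {f : M →ₗ[A] N}
    (hf : ∃ s : B ⊗[A] N →ₗ[B] B ⊗[A] M, s ∘ₗ f.baseChange B = LinearMap.id) :
    ∃ s : N →ₗ[A] M, s ∘ₗ f = LinearMap.id := by
  obtain ⟨s, hs⟩ := hf
  have hmk : Function.Surjective (TensorProduct.mk A B M 1) :=
    TensorProduct.mk_surjective A M B hsurj
  -- `t` lifts `s` through the surjections `N → B ⊗ N` and `M → B ⊗ M`, so that `t ∘ f` is the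
  -- identity after base change.
  obtain ⟨t, ht⟩ := Module.projective_lifting_property (TensorProduct.mk A B M 1)
    (s.restrictScalars A ∘ₗ TensorProduct.mk A B N 1) hmk
  have ht' : ∀ x, (1 : B) ⊗ₜ[A] t x = s (1 ⊗ₜ x) := LinearMap.congr_fun ht
  have htop : (LinearMap.range (t ∘ₗ f)).baseChange B = ⊤ := by
    rw [eq_top_iff]
    intro x _
    induction x with
    | zero => exact zero_mem _
    | add x y hx hy => exact add_mem (hx trivial) (hy trivial)
    | tmul b x =>
      have h1 : (1 : B) ⊗ₜ[A] (t (f x)) = 1 ⊗ₜ x := by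
        rw [ht', ← LinearMap.baseChange_tmul]
        exact LinearMap.congr_fun hs _
      have h2 : b ⊗ₜ[A] x = b ⊗ₜ (t (f x)) := by
        have := congrArg (b • ·) h1
        simpa [TensorProduct.smul_tmul'] using this.symm
      rw [h2]
      exact Submodule.tmul_mem_baseChange_of_mem _ ⟨x, rfl⟩
  have hs' := LinearMap.range_eq_top.1 (eq_top_of_baseChange_eq_top hsurj hker htop)
  let e := LinearEquiv.ofBijective (t ∘ₗ f)
    ⟨OrzechProperty.injective_of_surjective_endomorphism _ hs', hs'⟩
  exact ⟨e.symm.toLinearMap ∘ₗ t, LinearMap.ext fun x => e.symm_apply_apply x⟩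

end Nakayama

/-! ### Base change of `MF^ff` -/

section BaseChange

variable {p : ℕ} {A : Type*} [CommRing A] {φ : A →+* A}
  {M : Type*} [AddCommGroup M] [Module A M]
  {F : ℤ → Type*} [∀ i, AddCommGroup (F i)] [∀ i, Module A (F i)]
  {B : Type*} [CommRing B] [Algebra A B] {ψ : B →+* B}

theorem BigModule.HasWeights.baseChange {X : BigModule p φ M F} {a b : ℤ} (hw : X.HasWeights a b)
    (h : ∀ a : A, ψ (algebraMap A B a) = algebraMap A B (φ a)) :
    (X.baseChange ψ h).HasWeights a b := by
  obtain ⟨h1, h2⟩ := hw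
  exact ⟨((LinearEquiv.ofBijective _ h1).baseChange A B _ _).bijective, inferInstance⟩

theorem BigModule.IsFontaineLaffaille.baseChange {X : BigModule p φ M F}
    (hX : X.IsFontaineLaffaille) (h : ∀ a : A, ψ (algebraMap A B a) = algebraMap A B (φ a)) :
    (X.baseChange ψ h).IsFontaineLaffaille := by
  have hι : ∀ i, ∃ s, s ∘ₗ (X.baseChange ψ h).ι i = LinearMap.id := by
    intro i
    obtain ⟨s, hs⟩ := (injective_and_exists_isCompl_range_iff (X.ι i)).1
      ⟨hX.ι_injective i, hX.ι_isCompl i⟩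
    refine ⟨s.baseChange B, ?_⟩
    change s.baseChange B ∘ₗ (X.ι i).baseChange B = _
    rw [← LinearMap.baseChange_comp, hs, LinearMap.baseChange_id]
  refine ⟨?_, fun i => ((injective_and_exists_isCompl_range_iff _).2 (hι i)).1,
    fun i => ((injective_and_exists_isCompl_range_iff _).2 (hι i)).2, ?_, ?_⟩
  · obtain ⟨⟨_, _⟩, h2⟩ := hX.finiteFree
    refine ⟨⟨inferInstance, inferInstance⟩, fun i => ?_⟩
    obtain ⟨_, _⟩ := h2 i
    exact ⟨inferInstance, inferInstance⟩
  · obtain ⟨N, hN⟩ := hX.eventually_zero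
    refine ⟨N, fun i hi => ?_⟩
    have := hN i hi
    infer_instance
  · rw [eq_top_iff, ← Submodule.baseChange_top, ← hX.span_frob, Submodule.baseChange_span,
      Submodule.span_le]
    rintro _ ⟨y, hy, rfl⟩
    obtain ⟨i, x, rfl⟩ := Set.mem_iUnion.1 hy
    refine Submodule.subset_span (Set.mem_iUnion.2 ⟨i, 1 ⊗ₜ x, ?_⟩)
    change semilinearBaseChange ψ h (X.frob i) _ = _
    rw [semilinearBaseChange_tmul, map_one]
    rfl

end BaseChange

/-! ### The filtration by the images of the `π_i` -/

section Filtration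

variable {p : ℕ} {A : Type*} [CommRing A] {φ : A →+* A}
  {M : Type*} [AddCommGroup M] [Module A M]
  {F : ℤ → Type*} [∀ i, AddCommGroup (F i)] [∀ i, Module A (F i)]

theorem BigModule.π_injective (X : BigModule p φ M F) (hι : ∀ i, Function.Injective (X.ι i))
    (i : ℤ) : Function.Injective (X.π i) := by
  obtain ⟨N, hN⟩ := X.π_bijective
  rcases le_total i N with hi | hi
  · exact (hN i hi).1
  have key : ∀ j : ℤ, Function.Injective (X.π (j - 1)) → Function.Injective (X.π j) := by
    intro j hj x y hxy
    exact hι j (hj (by rw [X.π_ι, X.π_ι, hxy]))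
  induction i, hi using Int.leInduction with
  | base => exact (hN N le_rfl).1
  | succ i hi ih => exact key (i + 1) (by rwa [add_sub_cancel_right])

theorem BigModule.π_surjective (X : BigModule p φ M F) {j : ℤ}
    (hj : Function.Surjective (X.π j)) (i : ℤ) (hi : i ≤ j) : Function.Surjective (X.π i) := by
  induction i, hi using Int.leInductionDown with
  | base => exact hj
  | pred i hi ih =>
    intro y
    obtain ⟨x, rfl⟩ := ih y
    exact ⟨_, X.π_ι i x⟩

theorem BigModule.range_π_le (X : BigModule p φ M F) {i j : ℤ} (hij : i - 1 = j) :
    LinearMap.range (X.π i) ≤ LinearMap.range (X.π j) := by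
  subst hij
  rintro _ ⟨x, rfl⟩
  exact ⟨_, X.π_ι i x⟩

theorem BigModule.exists_compl_range_π {X : BigModule p φ M F} (hX : X.IsFontaineLaffaille)
    {i j : ℤ} (hij : i - 1 = j) :
    ∃ Q, LinearMap.range (X.π i) ⊔ Q = LinearMap.range (X.π j) ∧
      Disjoint (LinearMap.range (X.π i)) Q := by
  subst hij
  obtain ⟨Q, hQ⟩ := hX.ι_isCompl i
  have h : LinearMap.range (X.π i) = (LinearMap.range (X.ι i)).map (X.π (i - 1)) := by
    rw [← LinearMap.range_comp]
    congr 1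
    exact LinearMap.ext fun x => (X.π_ι i x).symm
  refine ⟨Q.map (X.π (i - 1)), ?_, ?_⟩
  · rw [h, ← Submodule.map_sup, hQ.sup_eq_top, Submodule.map_top]
  · rw [h]
    exact (Submodule.disjoint_map (X.π_injective hX.ι_injective _)) hQ.disjoint

/-- In nonpositive degrees, where `F^i` is identified with `M`, one has `φ_i = p^{-i} φ_0`. -/
theorem BigModule.frob_eq_pow_smul {X : BigModule p φ M F}
    (hinj : ∀ i, Function.Injective (X.π i)) (hsurj : Function.Surjective (X.π 0))
    (i : ℤ) (hi : i ≤ 0) (x : F i) (y : F 0) (hxy : X.π i x = X.π 0 y) :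
    X.frob i x = (p : A) ^ (-i).toNat • X.frob 0 y := by
  induction i, hi using Int.leInductionDown with
  | base => simp [hinj 0 hxy]
  | pred i hi ih =>
    obtain ⟨z, hz⟩ := X.π_surjective hsurj i hi (X.π 0 y)
    have hx : x = X.ι i z := hinj _ (by rw [hxy, X.π_ι, hz])
    have hn : (-(i - 1)).toNat = (-i).toNat + 1 := by lia
    rw [hx, X.frob_ι, ih z hz, hn, pow_succ', mul_smul]

/-- The divided Frobenius `φ_i` as a map on the image of `F^i` in `M`, for `π_i` injective. -/
noncomputable def BigModule.rangeFrob (X : BigModule p φ M F) (hinj : ∀ i, Function.Injective (X.π i)) (i : ℤ) :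
    LinearMap.range (X.π i) →ₛₗ[φ] M :=
  (X.frob i).comp (LinearEquiv.ofInjective (X.π i) (hinj i)).symm.toLinearMap

theorem BigModule.rangeFrob_eq (X : BigModule p φ M F) (hinj : ∀ i, Function.Injective (X.π i))
    {i j : ℤ} (hij : i = j) (x : LinearMap.range (X.π i)) (y : F j) (h : x = X.π j y) :
    X.rangeFrob hinj i x = X.frob j y := by
  subst hij
  have : x = LinearEquiv.ofInjective (X.π i) (hinj i) y := Subtype.ext h
  simp [this, rangeFrob]

end Filtration

/-! ### Objects of `MF^ff(W(κ))` are classical -/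

section Classical

variable {p : ℕ} [Fact p.Prime] {κ : Type*} [CommRing κ] [CharP κ p] [PerfectRing κ p]
  {M : Type*} [AddCommGroup M] [Module (WittVector p κ) M]
  {F : ℤ → Type*} [∀ i, AddCommGroup (F i)] [∀ i, Module (WittVector p κ) (F i)]
  {X : BigModule p (WittVector.frobenius (p := p) (R := κ)) M F} {r : ℕ}

/-- `φ_i(F^i)` is a `W(κ)`-submodule because the Frobenius of `W(κ)` is surjective, and for `i < 0`
it lies in `φ_0(F^0)`. -/
theorem BigModule.IsFontaineLaffaille.iSup_range_frob (hX : X.IsFontaineLaffaille)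
    (hw : X.HasWeights 0 r) :
    ⨆ n : ℕ, (X.rangeFrob (X.π_injective hX.ι_injective) n).toAddMonoidHom.range = ⊤ := by
  have hinj := X.π_injective hX.ι_injective
  let G : AddSubgroup M := ⨆ n : ℕ, (X.rangeFrob hinj n).toAddMonoidHom.range
  have hsmul : ∀ (a : WittVector p κ) (x : M), x ∈ G → a • x ∈ G := by
    intro a x hx
    obtain ⟨b, rfl⟩ := (WittVector.frobenius_bijective p κ).2 a
    induction hx using AddSubgroup.iSup_induction' with
    | hp n x hx =>
      obtain ⟨y, rfl⟩ := hx
      refine AddSubgroup.mem_iSup_of_mem n ⟨b • y, ?_⟩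
      exact (X.rangeFrob hinj n).map_smulₛₗ b y
    | h1 => rw [smul_zero]; exact zero_mem _
    | hadd x y _ _ hx hy => rw [smul_add]; exact add_mem hx hy
  let S : Submodule (WittVector p κ) M := { G with smul_mem' := hsmul }
  have hmem : ∀ (n : ℕ) (x : F n), X.frob n x ∈ S := fun n x =>
    AddSubgroup.mem_iSup_of_mem (S := fun n : ℕ => (X.rangeFrob hinj n).toAddMonoidHom.range) n
      ⟨⟨X.π n x, x, rfl⟩, X.rangeFrob_eq hinj rfl _ x rfl⟩
  have hS : S = ⊤ := by
    rw [eq_top_iff, ← hX.span_frob, Submodule.span_le]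
    intro y hy
    obtain ⟨i, x, rfl⟩ := Set.mem_iUnion.1 hy
    rcases le_total 0 i with hi | hi
    · lift i to ℕ using hi
      exact hmem i x
    · obtain ⟨y, hy⟩ := hw.1.2 (X.π i x)
      rw [frob_eq_pow_smul hinj hw.1.2 i hi x y hy.symm]
      exact S.smul_mem _ (hmem 0 y)
  exact (AddSubgroup.eq_top_iff' G).2 fun x => (hS ▸ Submodule.mem_top : x ∈ S)

/-- The classical Fontaine-Laffaille module of an object of `MF^ff(W(κ))` with weights in `[0, r]`:
the filtration consists of the images of the maps `π_i`. -/
noncomputable def BigModule.IsFontaineLaffaille.toClassical (hX : X.IsFontaineLaffaille)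
    (hw : X.HasWeights 0 r) : ClassicalModule p r κ M where
  finite := hX.finiteFree.1.1
  free := hX.finiteFree.1.2
  Fil n := LinearMap.range (X.π n)
  Fil_succ_le n := X.range_π_le (by push_cast; ring)
  exists_compl n := exists_compl_range_π hX (by push_cast; ring)
  Fil_zero := LinearMap.range_eq_top.2 hw.1.2
  Fil_last := by
    have : Subsingleton (F (r + 1 : ℕ)) := by exact_mod_cast hw.2
    rw [LinearMap.range_eq_bot]
    exact LinearMap.ext fun x => by rw [Subsingleton.elim x 0, map_zero, map_zero]
  frob n := X.rangeFrob (X.π_injective hX.ι_injective) n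
  frob_succ n x := by
    obtain ⟨_, y, rfl⟩ := x
    rw [X.rangeFrob_eq _ rfl ⟨_, y, rfl⟩ y rfl, ← X.frob_ι]
    exact X.rangeFrob_eq _ (by push_cast; ring) _ _ (X.π_ι _ y).symm
  sum_frob := hX.iSup_range_frob hw

theorem BigModule.IsFontaineLaffaille.isClassical (hX : X.IsFontaineLaffaille)
    (hw : X.HasWeights 0 r) : X.IsClassical r := by
  have hinj := X.π_injective hX.ι_injective
  have hrange : ∀ i : ℤ, LinearMap.range (X.π i) = LinearMap.range (X.π (i.toNat : ℤ)) := by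
    intro i
    rcases le_total 0 i with hi | hi
    · rw [Int.toNat_of_nonneg hi]
    · rw [Int.toNat_of_nonpos hi, LinearMap.range_eq_top.2 (X.π_surjective hw.1.2 i hi)]
      exact (LinearMap.range_eq_top.2 hw.1.2).symm
  refine ⟨hX.toClassical hw, ⟨{
    equiv := LinearEquiv.refl _ _
    filEquiv := fun i => (LinearEquiv.ofInjective (X.π i) (hinj i)).trans
      (LinearEquiv.ofEq _ _ (hrange i))
    filEquiv_ι := fun i x => Subtype.ext (X.π_ι i x)
    equiv_π := fun i x => rfl
    equiv_frob := fun i x => ?_ }⟩⟩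
  change X.frob i x = (p : WittVector p κ) ^ (-i).toNat • X.rangeFrob hinj (i.toNat : ℤ)
    ⟨X.π i x, _⟩
  rcases le_total 0 i with hi | hi
  · rw [X.rangeFrob_eq hinj (Int.toNat_of_nonneg hi) _ x rfl, Int.toNat_of_nonpos (by lia),
      pow_zero, one_smul]
  · obtain ⟨y, hy⟩ := hw.1.2 (X.π i x)
    rw [X.rangeFrob_eq hinj (j := 0) (by lia) _ y hy.symm]
    exact frob_eq_pow_smul hinj hw.1.2 i hi x y hy.symm

end Classical

/-! ### Descent from a classical base change -/

section Descent

variable {p : ℕ} [Fact p.Prime] {κ : Type*} [CommRing κ]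

theorem ClassicalModule.exists_retraction_ι {r : ℕ} {M : Type*} [AddCommGroup M]
    [Module (WittVector p κ) M] (C : ClassicalModule p r κ M) (i : ℤ) :
    ∃ s, s ∘ₗ C.toBig.ι i = LinearMap.id := by
  -- In degrees `i ≤ 0` both terms are `Fil 0`, as `Int.toNat` truncates.
  rcases le_or_gt i 0 with hi | hi
  · have h : C.Fil i.toNat = C.Fil (i - 1).toNat := by congr 1; lia
    exact exists_retraction_inclusion (Q := ⊥) h.le (by rw [sup_bot_eq, h]) disjoint_bot_right
  · obtain ⟨Q, hQ⟩ := C.exists_compl (i - 1).toNat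
    have h : (i - 1).toNat + 1 = i.toNat := by lia
    rw [h] at hQ
    exact exists_retraction_inclusion (hQ.1 ▸ le_sup_left) hQ.1 hQ.2

variable {A : Type*} [CommRing A] {φ : A →+* A} [Algebra A (WittVector p κ)]
  {M : Type*} [AddCommGroup M] [Module A M]
  {F : ℤ → Type*} [∀ i, AddCommGroup (F i)] [∀ i, Module A (F i)]

/-- Along a surjection `A → W(κ)` with kernel in the Jacobson radical, a finite free big module whose
base change is classical lies in `MF^ff(A)`. -/
theorem BigModule.IsFiniteFree.isFontaineLaffaille_of_isClassical_baseChange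
    {X : BigModule p φ M F} (hX : X.IsFiniteFree)
    (h : ∀ a : A, WittVector.frobenius (algebraMap A (WittVector p κ) a) =
      algebraMap A (WittVector p κ) (φ a))
    (hsurj : Function.Surjective (algebraMap A (WittVector p κ)))
    (hker : RingHom.ker (algebraMap A (WittVector p κ)) ≤ (⊥ : Ideal A).jacobson)
    {r : ℕ} (hcl : (X.baseChange WittVector.frobenius h).IsClassical r) :
    X.IsFontaineLaffaille := by
  obtain ⟨C, ⟨e⟩⟩ := hcl
  have hfin := fun i => (hX.2 i).1
  have hfree := fun i => (hX.2 i).2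
  have hM := hX.1.1
  have hι : ∀ i, ∃ s, s ∘ₗ X.ι i = LinearMap.id := by
    intro i
    refine exists_retraction_of_baseChange hsurj hker ?_
    obtain ⟨s, hs⟩ := C.exists_retraction_ι i
    refine ⟨(e.filEquiv i).symm.toLinearMap ∘ₗ s ∘ₗ (e.filEquiv (i - 1)).toLinearMap,
      LinearMap.ext fun x => (e.filEquiv i).symm_apply_eq.2 ?_⟩
    exact (congrArg s (e.filEquiv_ι i x)).trans (LinearMap.congr_fun hs _)
  refine ⟨hX, fun i => ((injective_and_exists_isCompl_range_iff _).2 (hι i)).1,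
    fun i => ((injective_and_exists_isCompl_range_iff _).2 (hι i)).2, ⟨r + 1, fun i hi => ?_⟩, ?_⟩
  · have hbot : C.Fil i.toNat = ⊥ :=
      le_bot_iff.1 (C.Fil_last ▸ antitone_nat_of_succ_le C.Fil_succ_le (by lia))
    have h1 : Subsingleton (C.Fil i.toNat) := by rw [hbot]; infer_instance
    have h2 : Subsingleton (WittVector p κ ⊗[A] F i) := (e.filEquiv i).injective.subsingleton
    exact subsingleton_of_subsingleton_baseChange hsurj hker
  · refine eq_top_of_baseChange_eq_top hsurj hker (eq_top_iff.2 fun x _ => ?_)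
    set T := (Submodule.span A (⋃ i, Set.range (X.frob i))).baseChange (WittVector p κ)
    have hfrob : ∀ (i : ℤ) (z : WittVector p κ ⊗[A] F i),
        (X.baseChange WittVector.frobenius h).frob i z ∈ T := by
      intro i z
      induction z with
      | zero => rw [map_zero]; exact zero_mem _
      | add x y hx hy => rw [map_add]; exact add_mem hx hy
      | tmul b z =>
        exact Submodule.tmul_mem_baseChange_of_mem _
          (Submodule.subset_span (Set.mem_iUnion.2 ⟨i, z, rfl⟩))
    have hle : ⨆ i, (C.frob i).toAddMonoidHom.range ≤
        (T.map e.equiv.toLinearMap).toAddSubgroup := by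
      refine iSup_le fun n => ?_
      rintro _ ⟨y, rfl⟩
      obtain ⟨z, rfl⟩ := (e.filEquiv n).surjective y
      refine ⟨_, hfrob n z, ?_⟩
      refine (e.equiv_frob n z).trans ?_
      have hn : (-(n : ℤ)).toNat = 0 := by lia
      change (p : WittVector p κ) ^ (-(n : ℤ)).toNat • C.frob n _ = C.frob n _
      rw [hn, pow_zero, one_smul]
    rw [C.sum_frob] at hle
    obtain ⟨y, hy, hyx⟩ := hle (AddSubgroup.mem_top (e.equiv x))
    exact e.equiv.injective hyx ▸ hy

end Descent

/-! ### The projection to the closed point -/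

section Fibres

variable (p : ℕ) [Fact p.Prime] (k : Type*) [Field k] (d : ℕ)

theorem closed_surjective :
    Function.Surjective (algebraMap (BaseRing p k d) (WittVector p k)) :=
  fun a => ⟨MvPowerSeries.C a, MvPowerSeries.constantCoeff_C a⟩

theorem closed_ker_le_jacobson :
    RingHom.ker (algebraMap (BaseRing p k d) (WittVector p k)) ≤
      (⊥ : Ideal (BaseRing p k d)).jacobson := by
  intro f hf
  rw [Ideal.mem_jacobson_bot]
  intro g
  have hf' : MvPowerSeries.constantCoeff f = 0 := hf
  rw [MvPowerSeries.isUnit_iff_constantCoeff, map_add, map_mul, hf', zero_mul, zero_add, map_one]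
  exact isUnit_one

end Fibres

end FL

theorem mainTheorem9 (p : ℕ) [Fact p.Prime] (hp : 2 < p)
    (k : Type*) [Field k] [CharP k p] [PerfectRing k p] (d : ℕ) (r : ℕ) (hr : r ≤ p - 2)
    (M : Type*) [AddCommGroup M] [Module (FL.BaseRing p k d) M]
    (F : ℤ → Type*) [∀ i, AddCommGroup (F i)] [∀ i, Module (FL.BaseRing p k d) (F i)]
    (X : FL.BigModule p (FL.frob p k d) M F) (hX : X.IsFiniteFree) (hw : X.HasWeights 0 r) :
    X.IsFontaineLaffaille ↔
      ((FL.closedFibre X).IsClassical r ∧ (FL.shilovFibre X).IsClassical r) ∧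
      Nonempty ((FL.ShilovRing p k d ⊗[FL.BaseRing p k d] M) ≃ₗ[FL.ShilovRing p k d]
        (FL.ShilovRing p k d ⊗[WittVector p k] (WittVector p k ⊗[FL.BaseRing p k d] M))) := by
  constructor
  · intro h
    refine ⟨⟨(h.baseChange (FL.closed_frob p k d)).isClassical (hw.baseChange _),
      (h.baseChange (FL.shilov_frob p k d)).isClassical (hw.baseChange _)⟩, ?_⟩
    have := hX.1.2
    let b := Module.Free.chooseBasis (FL.BaseRing p k d) M
    exact ⟨(b.baseChange (FL.ShilovRing p k d)).equiv
      ((b.baseChange (WittVector p k)).baseChange (FL.ShilovRing p k d)) (Equiv.refl _)⟩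
  · rintro ⟨⟨h, -⟩, -⟩
    exact hX.isFontaineLaffaille_of_isClassical_baseChange (FL.closed_frob p k d)
      (FL.closed_surjective p k d) (FL.closed_ker_le_jacobson p k d) h
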